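/- Trees are finite, unweighted and undirected, and $\operatorname{dist}_T(u,v)$ is the number of edges on the path from $u$ to $v$ in the tree $T$. For $s\ge 1$, an $s$-stretch distance labeling scheme for $n$-node trees consists of an encoder $e$, which assigns to every node $u$ of every $n$-node tree $T$ a label $e_T(u)\in\{0,1\}^*$, and a decoder $d:\{0,1\}^*\times\{0,1\}^*\to\mathbb{Z}_{\ge 0}$ such that, for every $n$-node tree $T$ and all nodes $u,v$ of $T$, $$\operatorname{dist}_T(u,v)\le d(e_T(u),e_T(v))\le s\cdot\operatorname{dist}_T(u,v).$$ The size of the scheme is the maximum length $|e_T(u)|$ over all $n$-node trees $T$ and all nodes $u$ of $T$. Theorem. For every constant $\varepsilon>0$, $(1+\varepsilon)$-stretch distance labeling schemes for $n$-node trees use $\Theta(\log n)$ bits: (i) there are a constant $C>0$ and a decoder $d$, both depending only on $\varepsilon$ (in particular $d$ knows neither the tree nor $n$), such that for every $n\ge 1$ there is an encoder $e$ for $n$-node trees for which $(e,d)$ is a $(1+\varepsilon)$-stretch distance labeling scheme of size at most $C\log_2 n$; (ii) for every $n\ge 1$, every $(1+\varepsilon)$-stretch distance labeling scheme for $n$-node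 trees (with a decoder that may depend on $n$) has size at least $\lfloor\log_2 n\rfloor$. -/

import Mathlib

namespace TreeLabeling

/-- The trees with `n` nodes (unweighted, with node set `Fin n`). -/
abbrev TreeOn (n : ℕ) : Type := {T : SimpleGraph (Fin n) // T.IsTree}

/-- An encoder for trees with `n` nodes: given the tree, it assigns a bit string to each node. -/
abbrev Encoder (n : ℕ) : Type := TreeOn n → Fin n → List Bool

/-- A decoder: it sees two labels only, neither the tree nor its number of nodes. -/
abbrev Decoder : Type := List Bool → List Bool → ℕ

/-- `(e, d)` is an `s`-stretch distance labeling scheme for trees with `n` nodes. -/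
def IsStretchScheme {n : ℕ} (s : ℝ) (e : Encoder n) (d : Decoder) : Prop :=
  ∀ (T : TreeOn n) (u v : Fin n),
    (T.1.dist u v : ℝ) ≤ (d (e T u) (e T v) : ℝ) ∧
      (d (e T u) (e T v) : ℝ) ≤ s * (T.1.dist u v : ℝ)

/-- The size of an encoder: the maximum label length over all trees with `n` nodes and all their
nodes (a supremum over a finite index set). -/
noncomputable def Encoder.size {n : ℕ} (e : Encoder n) : ℕ :=
  ⨆ p : TreeOn n × Fin n, (e p.1 p.2).length

/-- The supremum in `Encoder.size` is a genuine upper bound. -/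
theorem Encoder.length_le_size {n : ℕ} (e : Encoder n) (T : TreeOn n) (v : Fin n) :
    (e T v).length ≤ Encoder.size e :=
  le_ciSup (f := fun p : TreeOn n × Fin n => (e p.1 p.2).length)
    (Set.finite_range _).bddAbove (T, v)

end TreeLabeling

/-! Upper bound. Cut the tree recursively, halving clusters within two cuts. When a cut at `p` first
separates `u` and `v`, dist(u,v) = dist(u,p) + dist(v,p), so both distances rounded to powers of 1 +
δ suffice. Storing such a level anew at each of the O(log n) cuts would be too long. Instead each
cluster has two boundary nodes `s`, `t`, a node tracks its levels for both, and each record stores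
level changes in unary.

The bits then telescope. The level for `s` never rises. The distance to `t` is clipped at `K` times
the distance to `s`, so its level rises by at most `κ` per cut, where `K ≤ (1 + δ) ^ κ`. Thus
current levels plus O(1) per remaining cut bound the label length (`HasLabels`,
`hasLabels_of_parts`). Clipping is harmless: if it hides dist(u,p), then `u` is so close to `s` that
the detour over `s` costs only a factor 1 + 2/K (`levelValue_add_mem_of_detour`).

Halving comes from `exists_centroid`, `exists_three_groups` and `exists_median`: project the
centroid to the path from `s` to `t`, cut there, and cut the part hanging off that path once more at
its centroid.

Lower bound. Equal labels force distance 0, so a single tree already needs `n` distinct strings. -/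

namespace TreeLabeling

/-! ### Betweenness, medians and centroids in trees -/

section TreeMetric

variable {V : Type*} {G : SimpleGraph V}

/-- The node `p` lies on a shortest path from `u` to `v`. -/
def Between (G : SimpleGraph V) (p u v : V) : Prop :=
  G.dist u v = G.dist u p + G.dist p v

theorem Between.symm {p u v : V} (h : Between G p u v) : Between G p v u := by
  unfold Between at *
  rw [G.dist_comm (u := v) (v := u), G.dist_comm (u := v) (v := p), G.dist_comm (u := p) (v := u)]
  omega

theorem between_left (p v : V) : Between G p p v := by simp [Between]

theorem between_right (p u : V) : Between G p u p := by simp [Between]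

theorem Between.dist_le {p u v : V} (h : Between G p u v) : G.dist u p ≤ G.dist u v := by
  unfold Between at h
  omega

theorem between_iff_mem_support (hG : G.IsTree) {p u v : V} :
    Between G p u v ↔ ∀ w : G.Walk u v, p ∈ w.support := by
  classical
  constructor
  · intro h w
    obtain ⟨w₁, h₁⟩ := hG.connected.exists_walk_length_eq_dist u p
    obtain ⟨w₂, h₂⟩ := hG.connected.exists_walk_length_eq_dist p v
    have hp : (w₁.append w₂).IsPath := by
      apply SimpleGraph.Walk.isPath_of_length_eq_dist
      rw [SimpleGraph.Walk.length_append, h₁, h₂, h]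
    have heq : w₁.append w₂ = w.bypass := congrArg Subtype.val
      ((hG.isAcyclic.subsingleton_path u v).elim ⟨_, hp⟩ ⟨_, w.bypass_isPath⟩)
    apply w.support_bypass_subset_support
    rw [← heq, SimpleGraph.Walk.mem_support_append_iff]
    exact Or.inl w₁.end_mem_support
  · intro h
    obtain ⟨w, hw⟩ := hG.connected.exists_walk_length_eq_dist u v
    have h₁ := SimpleGraph.dist_le (w.takeUntil p (h w))
    have h₂ := SimpleGraph.dist_le (w.dropUntil p (h w))
    have h₃ := congrArg SimpleGraph.Walk.length (w.take_spec (h w))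
    rw [SimpleGraph.Walk.length_append] at h₃
    have h₄ := hG.connected.dist_triangle (u := u) (v := p) (w := v)
    unfold Between
    omega

/-- Two walks avoiding `p` concatenate to one avoiding `p`. Hence "not separated by `p`" is
transitive, which is how branches at `p` are handled throughout. -/
theorem Between.or (hG : G.IsTree) {p u w : V} (h : Between G p u w) (v : V) :
    Between G p u v ∨ Between G p v w := by
  rw [between_iff_mem_support hG] at *
  rw [between_iff_mem_support hG]
  by_contra! hc
  obtain ⟨⟨w₁, h₁⟩, ⟨w₂, h₂⟩⟩ := hc
  have := h (w₁.append w₂)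
  rw [SimpleGraph.Walk.mem_support_append_iff] at this
  tauto

theorem dist_adj_of_not_between (hG : G.IsTree) {p q u : V} (hpq : G.Adj p q)
    (h : ¬ Between G p u q) : G.dist u q + 1 = G.dist u p := by
  have h₁ := hG.dist_ne_of_adj u hpq
  have h₂ := hG.connected.dist_triangle (u := u) (v := p) (w := q)
  have h₃ := hG.connected.dist_triangle (u := u) (v := q) (w := p)
  have h₄ : G.dist p q = 1 := SimpleGraph.dist_eq_one_iff_adj.2 hpq
  have h₅ : G.dist q p = 1 := SimpleGraph.dist_eq_one_iff_adj.2 hpq.symm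
  unfold Between at h
  omega

theorem exists_adj_dist_add_one (hG : G.IsTree) {p q : V} (hpq : p ≠ q) :
    ∃ p', G.Adj p p' ∧ G.dist q p' + 1 = G.dist q p := by
  obtain ⟨w, hw⟩ := hG.connected.exists_walk_length_eq_dist p q
  cases w with
  | nil => exact absurd rfl hpq
  | cons hadj w' =>
    refine ⟨_, hadj, ?_⟩
    apply dist_adj_of_not_between hG hadj
    intro hb
    have h₁ := SimpleGraph.dist_le w'
    have h₂ : G.dist p _ = 1 := SimpleGraph.dist_eq_one_iff_adj.2 hadj
    rw [SimpleGraph.Walk.length_cons] at hw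
    unfold Between at hb
    rw [G.dist_comm (u := q), G.dist_comm (u := q)] at hb
    omega

theorem not_between_of_dist_add_one {p p' q : V} (h : G.dist q p' + 1 = G.dist q p) :
    ¬ Between G p q p' := by
  unfold Between
  omega

/-- Any three nodes of a tree have a median. -/
theorem exists_median (hG : G.IsTree) (q s t : V) :
    ∃ p, Between G p s t ∧ Between G p q s ∧ Between G p q t := by
  classical
  -- The median is the node between `s` and `t` nearest to `q`: were it not between `q` and `s`, its
  -- neighbour towards `q` would still lie between `s` and `t`.
  have hex : ∃ k, ∃ p, Between G p s t ∧ G.dist q p = k := ⟨_, s, between_left s t, rfl⟩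
  obtain ⟨p, hp, hk⟩ := Nat.find_spec hex
  have key : ∀ s t : V, Between G p s t → (∀ p', Between G p' s t → G.dist q p ≤ G.dist q p') →
      Between G p q s := by
    intro s t hst hmin
    by_contra hc
    have hpq : p ≠ q := by
      rintro rfl
      exact hc (between_left _ _)
    obtain ⟨p', hadj, hp'⟩ := exists_adj_dist_add_one hG hpq
    have h₁ : ¬ Between G p s p' := by
      intro h
      rcases h.or hG q with h | h
      · exact hc h.symm
      · exact not_between_of_dist_add_one hp' h
    have h₂ := dist_adj_of_not_between hG hadj h₁
    have h₃ := hG.connected.dist_triangle (u := p') (v := p) (w := t)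
    have h₄ : G.dist p' p = 1 := SimpleGraph.dist_eq_one_iff_adj.2 hadj.symm
    have h₅ := hG.connected.dist_triangle (u := s) (v := p') (w := t)
    have h₆ := hmin p' (by unfold Between at *; omega)
    omega
  have hmin : ∀ p', Between G p' s t → G.dist q p ≤ G.dist q p' := fun p' h => by
    rw [hk]
    exact Nat.find_min' hex ⟨p', h, rfl⟩
  exact ⟨p, hp, key s t hp hmin, key t s hp.symm fun p' h => hmin p' h.symm⟩

/-- A set of nodes of a finite tree has a centroid. -/
theorem exists_centroid [Fintype V] (hG : G.IsTree) (C : Finset V) :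
    ∃ q, ∀ v, ∀ D ⊆ C, (∀ u ∈ D, ¬ Between G q u v) → 2 * D.card ≤ C.card := by
  classical
  have : Nonempty V := hG.connected.nonempty
  -- A step from the minimizer towards `v` gains one for each node of `D` and loses at most one for
  -- every other node of `C`.
  obtain ⟨q, hq⟩ := Finite.exists_min fun q => ∑ u ∈ C, G.dist u q
  refine ⟨q, fun v D hDC hD => ?_⟩
  by_contra! hc
  obtain ⟨u₀, hu₀⟩ : D.Nonempty := Finset.card_pos.1 (by omega)
  have hqv : q ≠ v := by
    rintro rfl
    exact hD u₀ hu₀ (between_right _ _)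
  obtain ⟨q', hadj, hq'⟩ := exists_adj_dist_add_one hG hqv
  have h₁ : ∑ u ∈ D, G.dist u q' + D.card = ∑ u ∈ D, G.dist u q := by
    rw [Finset.card_eq_sum_ones, ← Finset.sum_add_distrib]
    refine Finset.sum_congr rfl fun u hu => dist_adj_of_not_between hG hadj fun h => ?_
    rcases h.or hG v with h | h
    · exact hD u hu h
    · exact not_between_of_dist_add_one hq' h
  have h₂ : ∑ u ∈ C \ D, G.dist u q' ≤ ∑ u ∈ C \ D, G.dist u q + (C \ D).card := by
    rw [Finset.card_eq_sum_ones, ← Finset.sum_add_distrib]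
    refine Finset.sum_le_sum fun u _ => ?_
    have := hG.connected.dist_triangle (u := u) (v := q) (w := q')
    rwa [SimpleGraph.dist_eq_one_iff_adj.2 hadj] at this
  have h₃ := Finset.sum_sdiff (f := fun u => G.dist u q') hDC
  have h₄ := Finset.sum_sdiff (f := fun u => G.dist u q) hDC
  have h₅ := Finset.card_sdiff_add_card_eq_card hDC
  have h₆ := hq q'
  omega

/-- The branches at `q` can be gathered into three groups of at most half the size. -/
theorem exists_three_groups (hG : G.IsTree) {C : Finset V} {q : V} {h : ℕ} (hh : 1 ≤ h)
    (hC : C.card ≤ 2 * h)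
    (hq : ∀ v, ∀ D ⊆ C, (∀ u ∈ D, ¬ Between G q u v) → D.card ≤ h) :
    ∃ g : V → ℕ, (∀ u, 1 ≤ g u ∧ g u ≤ 3) ∧
      (∀ u ∈ C, ∀ v ∈ C, g u ≠ g v → Between G q u v) ∧
      ∀ i, ∀ D ⊆ C, (∀ u ∈ D, g u = i) → D.card ≤ h := by
  classical
  -- `F` holds the unions of branches of size at most `h`. If `J` is a largest one and `B` a further
  -- branch, then `J ∪ B` exceeds `h`, which leaves fewer than `h` nodes.
  let F : Finset (Finset V) := C.powerset.filter fun J =>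
    J.card ≤ h ∧ ∀ u ∈ J, ∀ v ∈ C, v ∉ J → Between G q u v
  have hF : F.Nonempty := ⟨∅, by simp [F]⟩
  obtain ⟨J, hJF, hJmax⟩ := F.exists_max_image Finset.card hF
  obtain ⟨hJC, hJh, hJ⟩ : J ⊆ C ∧ J.card ≤ h ∧ ∀ u ∈ J, ∀ v ∈ C, v ∉ J → Between G q u v := by
    simpa [F] using hJF
  by_cases hJeq : J = C
  · subst hJeq
    exact ⟨fun _ => 1, by simp, by simp, fun i D hD _ => (Finset.card_le_card hD).trans hJh⟩
  obtain ⟨i₀, hi₀, hi₀J⟩ : ∃ i ∈ C, i ∉ J := by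
    by_contra! hc
    exact hJeq (hJC.antisymm hc)
  -- The clause `v = i₀` matters only for `i₀ = q`, which forms a branch by itself.
  let B : Finset V := C.filter fun v => v = i₀ ∨ ¬ Between G q v i₀
  have hBC : B ⊆ C := Finset.filter_subset _ _
  have hmemB : ∀ v, v ∈ B ↔ v ∈ C ∧ (v = i₀ ∨ ¬ Between G q v i₀) := by simp [B]
  have hB : ∀ u ∈ B, ∀ v ∈ C, v ∉ B → Between G q u v := by
    intro u hu v hv hvB
    rw [hmemB] at hu hvB
    have hv' : Between G q v i₀ := by tauto
    rcases hu.2 with rfl | hu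
    · exact hv'.symm
    · rcases hv'.or hG u with h | h
      · exact h.symm
      · exact absurd h hu
  have hJB : Disjoint J B := by
    rw [Finset.disjoint_left]
    intro u hu huB
    rw [hmemB] at huB
    rcases huB.2 with rfl | h
    · exact hi₀J hu
    · exact h (hJ u hu i₀ hi₀ hi₀J)
  have hBh : B.card ≤ h := by
    by_cases hqi : q = i₀
    · have : B ⊆ {i₀} := by
        intro v hv
        rw [hmemB] at hv
        rcases hv.2 with rfl | h
        · simp
        · subst hqi
          exact absurd (between_right _ _) h
      exact (Finset.card_le_card this).trans (by simpa using hh)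
    · refine hq i₀ B hBC fun u hu => ?_
      rw [hmemB] at hu
      rcases hu.2 with rfl | h
      · intro hb
        unfold Between at hb
        have := (hG.connected u q).dist_eq_zero_iff.1 (by
          rw [SimpleGraph.dist_self] at hb
          omega)
        exact hqi this.symm
      · exact h
  have hbig : h < J.card + B.card := by
    rw [← Finset.card_union_of_disjoint hJB]
    by_contra! hc
    have hmem : J ∪ B ∈ F := by
      simp only [F, Finset.mem_filter, Finset.mem_powerset]
      refine ⟨Finset.union_subset hJC hBC, hc, fun u hu v hv hvn => ?_⟩
      rw [Finset.mem_union, not_or] at hvn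
      rcases Finset.mem_union.1 hu with hu | hu
      · exact hJ u hu v hv hvn.1
      · exact hB u hu v hv hvn.2
    have h₁ := hJmax _ hmem
    rw [Finset.card_union_of_disjoint hJB] at h₁
    have : 0 < B.card := Finset.card_pos.2 ⟨i₀, (hmemB _).2 ⟨hi₀, Or.inl rfl⟩⟩
    omega
  refine ⟨fun u => if u ∈ J then 1 else if u ∈ B then 2 else 3, ?_, ?_, ?_⟩
  · intro u
    dsimp only
    split_ifs <;> omega
  · intro u hu v hv huv
    dsimp only at huv
    by_cases h₁ : u ∈ J <;> by_cases h₂ : v ∈ J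
    · simp [h₁, h₂] at huv
    · exact hJ u h₁ v hv h₂
    · exact (hJ v h₂ u hu h₁).symm
    · by_cases h₃ : u ∈ B <;> by_cases h₄ : v ∈ B
      · simp [h₁, h₂, h₃, h₄] at huv
      · exact hB u h₃ v hv h₄
      · exact (hB v h₄ u hu h₃).symm
      · simp [h₁, h₂, h₃, h₄] at huv
  · intro i D hD hi
    dsimp only at hi
    have hcases : D ⊆ J ∨ D ⊆ B ∨ D ⊆ C \ (J ∪ B) := by
      by_cases h₁ : i = 1
      · refine Or.inl fun u hu => ?_
        have := hi u hu
        grind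
      by_cases h₂ : i = 2
      · refine Or.inr (Or.inl fun u hu => ?_)
        have := hi u hu
        grind
      · refine Or.inr (Or.inr fun u hu => ?_)
        have := hi u hu
        grind
    rcases hcases with hc | hc | hc
    · exact (Finset.card_le_card hc).trans hJh
    · exact (Finset.card_le_card hc).trans hBh
    · have h₁ := Finset.card_le_card hc
      have h₂ := Finset.card_sdiff_add_card_eq_card (Finset.union_subset hJC hBC)
      rw [Finset.card_union_of_disjoint hJB] at h₂
      omega

end TreeMetric

/-! ### Rounding distances to powers of 1 + δ -/

section Rounding

/-- The values to which distances are rounded: `0` and the powers of `1 + δ`. -/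
noncomputable def levelValue (δ : ℝ) : ℕ → ℝ
  | 0 => 0
  | k + 1 => (1 + δ) ^ k

/-- The least level whose value is at least `x`. -/
noncomputable def level (δ : ℝ) (x : ℕ) : ℕ := sInf {k | (x : ℝ) ≤ levelValue δ k}

variable {δ : ℝ}

theorem level_le {x k : ℕ} (h : (x : ℝ) ≤ levelValue δ k) : level δ x ≤ k := Nat.sInf_le h

theorem le_levelValue_level (hδ : 0 < δ) (x : ℕ) : (x : ℝ) ≤ levelValue δ (level δ x) := by
  have hne : {k | (x : ℝ) ≤ levelValue δ k}.Nonempty := by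
    obtain ⟨k, hk⟩ := pow_unbounded_of_one_lt (x : ℝ) (show 1 < 1 + δ by linarith)
    exact ⟨k + 1, hk.le⟩
  exact Nat.sInf_mem hne

theorem level_zero : level δ 0 = 0 :=
  Nat.le_zero.1 (level_le (by simp [levelValue]))

theorem levelValue_level_le (hδ : 0 < δ) (x : ℕ) :
    levelValue δ (level δ x) ≤ (1 + δ) * x := by
  rcases Nat.eq_zero_or_pos x with rfl | hx
  · simp [level_zero, levelValue]
  have hx' : (1 : ℝ) ≤ x := by exact_mod_cast hx
  rcases hk : level δ x with _ | _ | k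
  · simp only [levelValue]
    positivity
  · simp only [levelValue, pow_zero]
    nlinarith
  · have : levelValue δ (k + 1) < x := by
      by_contra! hc
      have := level_le hc
      omega
    simp only [levelValue] at *
    rw [pow_succ, mul_comm]
    exact mul_le_mul_of_nonneg_left this.le (by linarith)

theorem level_mono (hδ : 0 < δ) {x y : ℕ} (h : x ≤ y) : level δ x ≤ level δ y :=
  level_le (le_trans (by exact_mod_cast h) (le_levelValue_level hδ y))

/-- This bounds how much the clipped level can rise at one cut. -/
theorem level_mul_le (hδ : 0 < δ) {K κ : ℕ} (hK : (K : ℝ) ≤ (1 + δ) ^ κ) (x : ℕ) :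
    level δ (K * x) ≤ level δ x + κ := by
  apply level_le
  have hx := le_levelValue_level hδ x
  rcases hk : level δ x with _ | k
  · rw [hk, levelValue] at hx
    have : x = 0 := by exact_mod_cast le_antisymm hx (by positivity)
    subst this
    rcases κ with _ | κ
    · simp [levelValue]
    · simp only [levelValue, mul_zero, Nat.cast_zero]
      positivity
  · rw [hk, levelValue] at hx
    rw [show k + 1 + κ = (k + κ) + 1 by ring, levelValue, pow_add, mul_comm ((1 + δ) ^ k)]
    push_cast
    exact mul_le_mul hK hx (by positivity) (by positivity)

theorem level_le_of_le_two_pow {c m x : ℕ} (hc : 2 ≤ (1 + δ) ^ c) (hx : x ≤ 2 ^ m) :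
    level δ x ≤ c * m + 1 := by
  apply level_le
  rw [levelValue, pow_mul]
  calc (x : ℝ) ≤ 2 ^ m := by exact_mod_cast hx
    _ ≤ _ := pow_le_pow_left₀ (by norm_num) hc m

end Rounding

/-! ### Labels, the estimate, and the recursive decomposition -/

section Labels

/-- The records that a node collects during the decomposition of the tree: the part it belongs to,
whether its distance to the separator is clipped, and the decrements of its two levels. -/
abbrev Label : Type := List (ℕ × Bool × ℕ × ℕ)

/-- The bit string of a label: each number is written in unary. -/
def toBits : Label → List Bool
  | [] => []
  | (r, f, x, y) :: l =>
    List.replicate r true ++ false :: f :: (List.replicate x true ++ false ::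
      (List.replicate y true ++ false :: toBits l))

theorem unary_append_injective {a b : ℕ} {l l' : List Bool}
    (h : List.replicate a true ++ false :: l = List.replicate b true ++ false :: l') :
    a = b ∧ l = l' := by
  induction a generalizing b with
  | zero => cases b <;> simp_all [List.replicate_succ]
  | succ a ih =>
    cases b with
    | zero => simp [List.replicate_succ] at h
    | succ b =>
      simp only [List.replicate_succ, List.cons_append, List.cons.injEq, true_and] at h
      simpa using ih h

theorem toBits_injective : Function.Injective toBits := by
  intro l
  induction l with
  | nil =>
    rintro (_ | ⟨⟨r, f, x, y⟩, l'⟩) h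
    · rfl
    · simp [toBits] at h
  | cons a l ih =>
    obtain ⟨r, f, x, y⟩ := a
    rintro (_ | ⟨⟨r', f', x', y'⟩, l'⟩) h
    · simp [toBits] at h
    · simp only [toBits] at h
      obtain ⟨rfl, h₁⟩ := unary_append_injective h
      obtain ⟨rfl, h₂⟩ := List.cons.inj h₁
      obtain ⟨rfl, h₃⟩ := unary_append_injective h₂
      obtain ⟨rfl, h₄⟩ := unary_append_injective h₃
      rw [ih h₄]

theorem length_toBits_cons (r x y : ℕ) (f : Bool) (l : Label) :
    (toBits ((r, f, x, y) :: l)).length = r + x + y + 4 + (toBits l).length := by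
  simp only [toBits, List.length_append, List.length_cons, List.length_replicate]
  omega

/-- The distance estimate read off two labels, given the current levels of the two nodes. -/
noncomputable def estimate (δ : ℝ) (κ : ℕ) : ℕ → ℕ → ℕ → ℕ → Label → Label → ℝ
  | a, b, a', b', (r, f, x, y) :: l, (r', f', x', y') :: l' =>
    if r = r' then estimate δ κ (a - x) (b + κ - y) (a' - x') (b' + κ - y') l l'
    else if r = 0 then
      if f then levelValue δ a + levelValue δ a'
      else levelValue δ (b + κ - y) + levelValue δ (a' - x')
    else if r' = 0 then
      if f' then levelValue δ a + levelValue δ a'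
      else levelValue δ (a - x) + levelValue δ (b' + κ - y')
    else levelValue δ (a - x) + levelValue δ (a' - x')
  | _, _, _, _, _, _ => 0

theorem estimate_nil (δ : ℝ) (κ a b a' b' : ℕ) (l : Label) :
    estimate δ κ a b a' b' [] l = 0 := by
  simp [estimate]

variable {V : Type*}

/-- The level of the distance from `u` to the second boundary node `t`, where that distance is
clipped at `K` times the distance to the first boundary node `s`. -/
noncomputable def clippedLevel (G : SimpleGraph V) (δ : ℝ) (K : ℕ) (s t u : V) : ℕ :=
  level δ (min (G.dist u t) (K * G.dist u s))

/-- The nodes in `C` have labels of length at most `k` plus their levels that determine their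
distances up to stretch `1 + ε`. -/
def HasLabels (G : SimpleGraph V) (ε δ : ℝ) (K κ k : ℕ) (C : Finset V) (s t : V) : Prop :=
  ∃ ℓ : V → Label,
    (∀ u ∈ C, (toBits (ℓ u)).length ≤ level δ (G.dist u s) + clippedLevel G δ K s t u + k) ∧
    ∀ u ∈ C, ∀ v ∈ C,
      estimate δ κ (level δ (G.dist u s)) (clippedLevel G δ K s t u)
        (level δ (G.dist v s)) (clippedLevel G δ K s t v) (ℓ u) (ℓ v) ∈
        Set.Icc (G.dist u v : ℝ) ((1 + ε) * G.dist u v)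

variable {G : SimpleGraph V} {ε δ : ℝ} {K κ k : ℕ} {C : Finset V} {s t : V}

theorem HasLabels.mono {k' : ℕ} (h : HasLabels G ε δ K κ k C s t) (hk : k ≤ k') :
    HasLabels G ε δ K κ k' C s t := by
  obtain ⟨ℓ, h₁, h₂⟩ := h
  exact ⟨ℓ, fun u hu => (h₁ u hu).trans (by omega), h₂⟩

/-- Only the distance of a node to itself occurs, and `estimate` defaults to 0 on empty labels. -/
theorem hasLabels_of_card_le_one (hC : C.card ≤ 1) : HasLabels G ε δ K κ 0 C s t := by
  refine ⟨fun _ => [], fun u _ => by simp [toBits], fun u hu v hv => ?_⟩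
  rw [Finset.card_le_one.1 hC u hu v hv]
  simp [estimate_nil]

/-- Two sums of rounded distances through a separating node. -/
theorem levelValue_add_mem (hδ : 0 < δ) (hδε : δ ≤ ε) {x y z : ℕ} (h : z = x + y) :
    levelValue δ (level δ x) + levelValue δ (level δ y) ∈ Set.Icc (z : ℝ) ((1 + ε) * z) := by
  have h₁ := le_levelValue_level hδ x
  have h₂ := le_levelValue_level hδ y
  have h₃ := levelValue_level_le hδ x
  have h₄ := levelValue_level_le hδ y
  subst h
  push_cast
  have hx : (0 : ℝ) ≤ x := by positivity
  have hy : (0 : ℝ) ≤ y := by positivity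
  constructor
  · linarith
  · nlinarith

/-- If `u` is much closer to `s` than to `v`, then the detour over `s` is affordable. -/
theorem levelValue_add_mem_of_detour (hδ : 0 < δ) (hK : 0 < K)
    (hKε : (1 + δ) * (1 + 2 / K) ≤ 1 + ε)
    {x y z : ℕ} (h₁ : z ≤ x + y) (h₂ : y ≤ x + z) (h₃ : K * x ≤ z) :
    levelValue δ (level δ x) + levelValue δ (level δ y) ∈ Set.Icc (z : ℝ) ((1 + ε) * z) := by
  have h₄ := le_levelValue_level hδ x
  have h₅ := le_levelValue_level hδ y
  have h₆ := levelValue_level_le hδ x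
  have h₇ := levelValue_level_le hδ y
  have h₁' : (z : ℝ) ≤ x + y := by exact_mod_cast h₁
  have h₂' : (y : ℝ) ≤ x + z := by exact_mod_cast h₂
  have h₃' : (K : ℝ) * x ≤ z := by exact_mod_cast h₃
  have hK' : (0 : ℝ) < K := by exact_mod_cast hK
  refine ⟨by linarith, ?_⟩
  have h₈ : (x : ℝ) ≤ z / K := by
    rw [le_div_iff₀ hK']
    linarith
  calc levelValue δ (level δ x) + levelValue δ (level δ y) ≤ (1 + δ) * (x + y) := by linarith
    _ ≤ (1 + δ) * (z + 2 * (z / K)) := mul_le_mul_of_nonneg_left (by linarith) (by linarith)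
    _ = (1 + δ) * (1 + 2 / K) * z := by ring
    _ ≤ _ := mul_le_mul_of_nonneg_right hKε (by positivity)

/-- The rounding parameters `δ`, `K`, `κ` suit the stretch `1 + ε`. -/
structure Suits (ε δ : ℝ) (K κ : ℕ) : Prop where
  pos : 0 < δ
  le : δ ≤ ε
  clip_pos : 0 < K
  detour : (1 + δ) * (1 + 2 / K) ≤ 1 + ε
  clip_le : (K : ℝ) ≤ (1 + δ) ^ κ

theorem exists_suits (hε : 0 < ε) : ∃ δ K κ, Suits ε δ K κ := by
  have hm : 0 < min ε 1 := lt_min hε one_pos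
  have h₁ : min ε 1 ≤ ε := min_le_left _ _
  have h₂ : min ε 1 ≤ 1 := min_le_right _ _
  generalize min ε 1 = m at hm h₁ h₂
  obtain ⟨K, hK⟩ := exists_nat_gt (6 / m)
  obtain ⟨κ, hκ⟩ := pow_unbounded_of_one_lt (K : ℝ) (show 1 < 1 + m / 3 by linarith)
  have hK₀ : (0 : ℝ) < K := lt_trans (by positivity) hK
  -- Rounding and detour each lose a factor of at most 1 + m/3, and (1 + m/3)² ≤ 1 + m as m ≤ 1.
  refine ⟨m / 3, K, κ, by linarith, by linarith, by exact_mod_cast hK₀, ?_, hκ.le⟩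
  have h₃ : 2 / (K : ℝ) ≤ m / 3 := by
    rw [div_lt_iff₀ hm] at hK
    rw [div_le_iff₀ hK₀]
    linarith
  calc (1 + m / 3) * (1 + 2 / K) ≤ (1 + m / 3) * (1 + m / 3) :=
        mul_le_mul_of_nonneg_left (by linarith) (by linarith)
    _ ≤ 1 + ε := by nlinarith

/-- Labels for the parts into which a node `p` separates `C` give labels for `C`. Part `0` keeps
the boundary node `s` and gets `p` as its second one; the other parts get `p` as the first one. -/
theorem hasLabels_of_parts (hG : G.Connected) (hpar : Suits ε δ K κ)
    {p : V} (r : V → ℕ) (σ τ : ℕ → V) (hσ₀ : σ 0 = s) (hσ : ∀ i ≠ 0, σ i = p) (hτ₀ : τ 0 = p)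
    (hr : ∀ u ∈ C, r u ≤ 3)
    (hsep : ∀ u ∈ C, ∀ v ∈ C, r u ≠ r v → Between G p u v)
    (hs : ∀ u ∈ C, r u ≠ 0 → G.dist u p ≤ G.dist u s)
    (hb : ∀ u ∈ C, min (G.dist u (τ (r u))) (K * G.dist u (σ (r u))) ≤
      K * min (G.dist u t) (K * G.dist u s))
    (hparts : ∀ i, ∀ D ⊆ C, (∀ u ∈ D, r u = i) → HasLabels G ε δ K κ k D (σ i) (τ i)) :
    HasLabels G ε δ K κ (k + κ + 7) C s t := by
  classical
  obtain ⟨hδ, hδε, hK, hKε, hKκ⟩ := hpar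
  choose ℓ hℓ₁ hℓ₂ using fun i => hparts i (C.filter fun u => r u = i) (Finset.filter_subset _ _)
    (by simp)
  have ha' : ∀ u ∈ C, level δ (G.dist u (σ (r u))) ≤ level δ (G.dist u s) := by
    intro u hu
    apply level_mono hδ
    by_cases h : r u = 0
    · rw [h, hσ₀]
    · rw [hσ _ h]
      exact hs u hu h
  have hb' : ∀ u ∈ C, clippedLevel G δ K (σ (r u)) (τ (r u)) u ≤ clippedLevel G δ K s t u + κ :=
    fun u hu => (level_mono hδ (hb u hu)).trans (level_mul_le hδ hKκ _)
  have hpart : ∀ u ∈ C, u ∈ C.filter fun u' => r u' = r u := fun u hu => by simp [hu]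
  let label : V → Label := fun u =>
    (r u, decide (K * G.dist u s < G.dist u p),
      level δ (G.dist u s) - level δ (G.dist u (σ (r u))),
      clippedLevel G δ K s t u + κ - clippedLevel G δ K (σ (r u)) (τ (r u)) u) :: ℓ (r u) u
  refine ⟨label, fun u hu => ?_, fun u hu v hv => ?_⟩
  · simp only [label, length_toBits_cons]
    have h₁ := hℓ₁ (r u) u (hpart u hu)
    have h₂ := ha' u hu
    have h₃ := hb' u hu
    have h₄ := hr u hu
    omega
  · simp only [label, estimate]
    -- No subtraction truncates, so the decoder recovers the levels for the new boundary nodes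
    -- exactly.
    rw [Nat.sub_sub_self (ha' u hu), Nat.sub_sub_self (ha' v hv), Nat.sub_sub_self (hb' u hu),
      Nat.sub_sub_self (hb' v hv)]
    have hub : ∀ u, r u = 0 → ¬ K * G.dist u s < G.dist u p →
        clippedLevel G δ K (σ (r u)) (τ (r u)) u = level δ (G.dist u p) := by
      intro u hu0 hc
      rw [hu0, hσ₀, hτ₀, clippedLevel, min_eq_left (not_lt.1 hc)]
    by_cases hrr : r u = r v
    · rw [if_pos hrr, hrr]
      exact hℓ₂ (r v) u (by simp [hu, hrr]) v (hpart v hv)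
    have hp := hsep u hu v hv hrr
    have hpuv : G.dist u v = G.dist u p + G.dist v p := by
      rw [G.dist_comm (u := v)]
      exact hp
    have t₁ := hG.dist_triangle (u := u) (v := s) (w := v)
    have t₂ := hG.dist_triangle (u := v) (v := u) (w := s)
    have t₃ := hG.dist_triangle (u := u) (v := v) (w := s)
    rw [G.dist_comm (u := s) (v := v)] at t₁
    rw [G.dist_comm (u := v) (v := u)] at t₂
    rw [if_neg hrr]
    by_cases hu0 : r u = 0
    · rw [if_pos hu0]
      have hv0 : r v ≠ 0 := fun h => hrr (hu0.trans h.symm)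
      -- If the distance to `p` is clipped, then dist(u,v) ≥ dist(u,p) > K · dist(u,s), and the old
      -- levels for `s` serve instead.
      by_cases hc : K * G.dist u s < G.dist u p
      · rw [if_pos (by simpa using hc)]
        exact levelValue_add_mem_of_detour hδ hK hKε t₁ (by omega) (by omega)
      · rw [if_neg (by simpa using hc), hub u hu0 hc, hσ _ hv0]
        exact levelValue_add_mem hδ hδε hpuv
    · rw [if_neg hu0]
      by_cases hv0 : r v = 0
      · rw [if_pos hv0]
        by_cases hc : K * G.dist v s < G.dist v p
        · rw [if_pos (by simpa using hc), add_comm (levelValue δ _)]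
          exact levelValue_add_mem_of_detour hδ hK hKε (by omega) (by omega) (by omega)
        · rw [if_neg (by simpa using hc), hub v hv0 hc, hσ _ hu0]
          exact levelValue_add_mem hδ hδε hpuv
      · rw [if_neg hv0, hσ _ hu0, hσ _ hv0]
        exact levelValue_add_mem hδ hδε hpuv

variable [Fintype V]

/-- A cluster with one boundary node is cut at its centroid. -/
theorem hasLabels_of_centroid (hG : G.IsTree) (hpar : Suits ε δ K κ) {h : ℕ} (hh : 1 ≤ h)
    (hC : C.card ≤ 2 * h) (ih : ∀ D s t, D.card ≤ h → HasLabels G ε δ K κ k D s t) :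
    HasLabels G ε δ K κ (k + κ + 7) C s s := by
  classical
  obtain ⟨q, hq⟩ := exists_centroid hG C
  have hq' : ∀ v, ∀ D ⊆ C, (∀ u ∈ D, ¬ Between G q u v) → D.card ≤ h := fun v D h₁ h₂ => by
    have := hq v D h₁ h₂
    omega
  obtain ⟨g, hg₁, hg₂, hg₃⟩ := exists_three_groups hG hh hC hq'
  have hK := hpar.clip_pos
  have hle : ∀ x : ℕ, x ≤ K * x := fun x => Nat.le_mul_of_pos_left x hK
  have hr₀ : ∀ u, (if Between G q u s then g u else 0) ≠ 0 → Between G q u s := fun u hu => by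
    by_contra hc
    simp [hc] at hu
  refine hasLabels_of_parts hG.connected hpar (p := q) (fun u => if Between G q u s then g u else 0)
    (fun i => if i = 0 then s else q) (fun _ => q) (by simp) (fun i hi => by simp [hi]) rfl
    ?_ ?_ ?_ ?_ ?_
  · intro u _
    have := hg₁ u
    split_ifs <;> omega
  · intro u hu v hv huv
    by_cases h₁ : Between G q u s <;> by_cases h₂ : Between G q v s
    · simp only [h₁, h₂, if_true] at huv
      exact hg₂ u hu v hv huv
    · exact (h₁.or hG v).resolve_right h₂
    · exact ((h₂.or hG u).resolve_right h₁).symm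
    · simp [h₁, h₂] at huv
  · exact fun u _ hu => (hr₀ u hu).dist_le
  · intro u _
    -- On the branch towards `s` the second boundary node moves from `s` to a possibly distant `q`;
    -- only the clip limits the growth, to a factor `K`.
    rw [min_eq_left (hle (G.dist u s))]
    by_cases h₁ : Between G q u s
    · exact (min_le_left _ _).trans (h₁.dist_le.trans (hle _))
    · simp [h₁]
  · intro i D hD hi
    apply ih
    by_cases hi₀ : i = 0
    · subst hi₀
      refine hq' s D hD fun u hu hb => ?_
      have h₁ := hi u hu
      have h₂ := hg₁ u
      rw [if_pos hb] at h₁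
      omega
    · refine hg₃ i D hD fun u hu => ?_
      have h₁ := hi u hu
      rw [if_pos (hr₀ u (by rwa [h₁]))] at h₁
      exact h₁

/-- A cluster with two boundary nodes is cut at the projection of its centroid to the path between
them. -/
theorem hasLabels_of_projection (hG : G.IsTree) (hpar : Suits ε δ K κ) {h : ℕ} (hh : 1 ≤ h)
    (hC : C.card ≤ 2 * h) (ih : ∀ D s t, D.card ≤ h → HasLabels G ε δ K κ k D s t) :
    HasLabels G ε δ K κ (k + 2 * (κ + 7)) C s t := by
  classical
  obtain ⟨q, hq⟩ := exists_centroid hG C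
  obtain ⟨p, hst, hqs, hqt⟩ := exists_median hG q s t
  have hside : ∀ x, Between G p q x → ∀ D ⊆ C, (∀ u ∈ D, ¬ Between G p u x) → D.card ≤ h := by
    intro x hx D hD hDx
    have : 2 * D.card ≤ C.card := by
      by_cases hpq : p = q
      · subst hpq
        exact hq x D hD hDx
      -- The centroid lies beyond `p` as seen from `x`, so this side is contained in the branch at
      -- `q` towards `p`.
      · refine hq p D hD fun u hu hb => hpq ?_
        have h₁ := ((hx.symm.or hG u).resolve_left fun h => hDx u hu h.symm)
        unfold Between at h₁ hb
        exact (hG.connected p q).dist_eq_zero_iff.1 (by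
          rw [G.dist_comm (u := q) (v := p)] at hb
          omega)
    omega
  have hK := hpar.clip_pos
  have hle : ∀ x : ℕ, x ≤ K * x := fun x => Nat.le_mul_of_pos_left x hK
  have hus : ∀ u, ¬ Between G p u s → Between G p u t := fun u hu =>
    ((hst.symm.or hG u).resolve_right hu).symm
  let r : V → ℕ := fun u => if ¬ Between G p u s then 0 else if ¬ Between G p u t then 1 else 2
  have hr₀ : ∀ u, r u = 0 ↔ ¬ Between G p u s := fun u => by
    simp only [r]
    split_ifs <;> simp_all
  have hr₁ : ∀ u, r u = 1 ↔ ¬ Between G p u t := fun u => by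
    have := hus u
    simp only [r]
    split_ifs <;> simp_all
  have hr₂ : ∀ u, r u ≤ 2 := fun u => by
    simp only [r]
    split_ifs <;> omega
  have hsplit : ∀ x u v, ¬ Between G p u x → Between G p v x → Between G p u v :=
    fun x u v h₁ h₂ => ((h₂.or hG u).resolve_right h₁).symm
  refine (hasLabels_of_parts (k := k + κ + 7) hG.connected hpar (p := p) r
    (fun i => if i = 0 then s else p) (fun i => if i = 1 then t else p) (by simp)
    (fun i hi => by simp [hi]) (by simp) ?_ ?_ ?_ ?_ ?_).mono (by omega)
  · exact fun u _ => (hr₂ u).trans (by norm_num)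
  · intro u _ v _ huv
    have hu := hr₂ u
    have hv := hr₂ v
    have hcases : (r u = 0 ∧ r v ≠ 0) ∨ (r v = 0 ∧ r u ≠ 0) ∨ (r u = 1 ∧ r v ≠ 1) ∨
        (r v = 1 ∧ r u ≠ 1) := by omega
    simp only [ne_eq, hr₀, hr₁, not_not] at hcases
    rcases hcases with ⟨h₁, h₂⟩ | ⟨h₁, h₂⟩ | ⟨h₁, h₂⟩ | ⟨h₁, h₂⟩
    · exact hsplit s u v h₁ h₂
    · exact (hsplit s v u h₁ h₂).symm
    · exact hsplit t u v h₁ h₂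
    · exact (hsplit t v u h₁ h₂).symm
  · intro u _ hu
    rw [ne_eq, hr₀, not_not] at hu
    exact hu.dist_le
  · intro u _
    -- Neither clipped term grows: a boundary node is replaced by `p` only if `p` lies on the way to
    -- it.
    refine le_trans (min_le_min ?_ (Nat.mul_le_mul_left K ?_)) (hle _)
    · split_ifs with h₁
      · exact le_rfl
      · rw [hr₁, not_not] at h₁
        exact h₁.dist_le
    · split_ifs with h₁
      · exact le_rfl
      · rw [hr₀, not_not] at h₁
        exact h₁.dist_le
  · intro i D hD hi
    by_cases h₀ : i = 0
    · subst h₀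
      exact (ih D _ _ (hside s hqs D hD fun u hu => (hr₀ u).1 (hi u hu))).mono (by omega)
    by_cases h₁ : i = 1
    · subst h₁
      exact (ih D _ _ (hside t hqt D hD fun u hu => (hr₁ u).1 (hi u hu))).mono (by omega)
    -- The part off the path may contain the centroid and need not be halved; it has the single
    -- boundary node `p` and is cut again, hence the factor 2 in the bound.
    · simp only [h₀, h₁, if_false]
      exact hasLabels_of_centroid hG hpar hh ((Finset.card_le_card hD).trans hC) ih

theorem hasLabels_of_card_le_two_pow (hG : G.IsTree) (hpar : Suits ε δ K κ) (m : ℕ) :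
    ∀ (C : Finset V) (s t : V), C.card ≤ 2 ^ m →
      HasLabels G ε δ K κ (m * (2 * (κ + 7))) C s t := by
  induction m with
  | zero =>
    intro C s t hC
    rw [zero_mul]
    exact hasLabels_of_card_le_one (by simpa using hC)
  | succ m ih =>
    intro C s t hC
    rw [add_one_mul]
    exact hasLabels_of_projection hG hpar (Nat.one_le_two_pow) (by rwa [pow_succ'] at hC) ih

end Labels

/-! ### The scheme with O(log n) bits -/

section UpperBound

/-- The decoder on labels that start with the level of the distance to the root. -/
noncomputable def estimateFromRoot (δ : ℝ) (κ : ℕ) : Label → Label → ℝ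
  | (_, _, a, _) :: l, (_, _, a', _) :: l' => estimate δ κ a a a' a' l l'
  | _, _ => 0

/-- The decoder on bit strings. -/
noncomputable def decoder (δ : ℝ) (κ : ℕ) : Decoder := fun x y =>
  ⌊estimateFromRoot δ κ (Function.invFun toBits x) (Function.invFun toBits y)⌋₊

theorem decoder_toBits (δ : ℝ) (κ : ℕ) (l l' : Label) :
    decoder δ κ (toBits l) (toBits l') = ⌊estimateFromRoot δ κ l l'⌋₊ := by
  rw [decoder, Function.leftInverse_invFun toBits_injective,
    Function.leftInverse_invFun toBits_injective]

/-- True distances are integers, so rounding an estimate down keeps it above them. -/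
theorem floor_mem_Icc {x b : ℝ} {a : ℕ} (h : x ∈ Set.Icc (a : ℝ) b) :
    (⌊x⌋₊ : ℝ) ∈ Set.Icc (a : ℝ) b :=
  ⟨by exact_mod_cast Nat.le_floor h.1,
    (Nat.floor_le ((Nat.cast_nonneg a).trans h.1)).trans h.2⟩

theorem dist_lt_card {V : Type*} [Fintype V] {G : SimpleGraph V} (hG : G.Connected) (u v : V) :
    G.dist u v < Fintype.card V := by
  obtain ⟨w, hp, hw⟩ := hG.exists_path_of_dist u v
  rw [← hw]
  exact hp.length_lt

variable {ε δ : ℝ} {K κ c : ℕ}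

theorem exists_tree_labels (hpar : Suits ε δ K κ) (hc : 2 ≤ (1 + δ) ^ c) {n : ℕ} (hn : 2 ≤ n)
    (T : TreeOn n) :
    ∃ ℓ : Fin n → Label, ∀ u,
      (toBits (ℓ u)).length ≤ (3 * c + 2 * (κ + 7) + 7) * (Nat.log 2 n + 1) ∧
      ∀ v, estimateFromRoot δ κ (ℓ u) (ℓ v) ∈
        Set.Icc (T.1.dist u v : ℝ) ((1 + ε) * T.1.dist u v) := by
  have hnm : n ≤ 2 ^ (Nat.log 2 n + 1) := (Nat.lt_pow_succ_log_self (by norm_num) n).le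
  generalize Nat.log 2 n = m at hnm
  let s : Fin n := ⟨0, by omega⟩
  obtain ⟨ℓ, hℓ₁, hℓ₂⟩ := hasLabels_of_card_le_two_pow T.2 hpar (m + 1) Finset.univ s s
    (by simpa using hnm)
  have hclip : ∀ u, clippedLevel T.1 δ K s s u = level δ (T.1.dist u s) := fun u => by
    rw [clippedLevel, min_eq_left (Nat.le_mul_of_pos_left _ hpar.clip_pos)]
  simp only [hclip] at hℓ₁ hℓ₂
  -- With `s` as both boundary nodes the two initial levels agree. The level is paid three times,
  -- once here and twice in the bound for `ℓ`, whence `3 * c`.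
  refine ⟨fun u => (0, false, level δ (T.1.dist u s), 0) :: ℓ u, fun u => ⟨?_, fun v => ?_⟩⟩
  · have h₁ := hℓ₁ u (Finset.mem_univ u)
    have h₂ : T.1.dist u s ≤ 2 ^ (m + 1) := by
      have := dist_lt_card T.2.connected u s
      rw [Fintype.card_fin] at this
      omega
    have h₃ := level_le_of_le_two_pow hc h₂
    rw [length_toBits_cons]
    nlinarith
  · exact hℓ₂ u (Finset.mem_univ u) v (Finset.mem_univ v)

theorem exists_encoder (hpar : Suits ε δ K κ) (hc : 2 ≤ (1 + δ) ^ c) {n : ℕ} (hn : 1 ≤ n) :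
    ∃ e : Encoder n, IsStretchScheme (1 + ε) e (decoder δ κ) ∧
      (Encoder.size e : ℝ) ≤ ((3 * c + 2 * (κ + 7) + 7) * 2 : ℕ) * Real.logb 2 n := by
  rcases hn.eq_or_lt with rfl | hn
  -- For `n = 1` the bound is 0, which forces the empty string.
  · refine ⟨fun _ _ => toBits [], fun T u v => ?_, ?_⟩
    · rw [decoder_toBits, Subsingleton.elim u v]
      simp [estimateFromRoot]
    · have h : Encoder.size (fun (_ : TreeOn 1) _ => toBits []) ≤ 0 := ciSup_le' fun _ => le_rfl
      simpa using h
  · choose ℓ hℓ using exists_tree_labels (n := n) hpar hc hn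
    refine ⟨fun T u => toBits (ℓ T u), fun T u v => ?_, ?_⟩
    · rw [decoder_toBits]
      exact floor_mem_Icc ((hℓ T u).2 v)
    · have h₁ : Encoder.size (fun T u => toBits (ℓ T u)) ≤
          (3 * c + 2 * (κ + 7) + 7) * (Nat.log 2 n + 1) := ciSup_le' fun p => (hℓ p.1 p.2).1
      have h₂ : 1 ≤ Nat.log 2 n := Nat.log_pos (by norm_num) hn
      have h₃ : (Nat.log 2 n : ℝ) ≤ Real.logb 2 n := by exact_mod_cast Real.natLog_le_logb n 2
      calc (Encoder.size (fun T u => toBits (ℓ T u)) : ℝ)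
          ≤ ((3 * c + 2 * (κ + 7) + 7) * (Nat.log 2 n + 1) : ℕ) := by exact_mod_cast h₁
        _ ≤ ((3 * c + 2 * (κ + 7) + 7) * 2 * Nat.log 2 n : ℕ) := by
          rw [Nat.cast_le, mul_assoc]
          exact Nat.mul_le_mul_left _ (by omega)
        _ ≤ _ := by
          rw [Nat.cast_mul]
          exact mul_le_mul_of_nonneg_left h₃ (Nat.cast_nonneg _)

end UpperBound

/-! ### Counting distinct labels -/

section LowerBound

/-- The number whose binary digits are those of the bit string, after a leading one. -/
def toNatLeadingOne : List Bool → ℕ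
  | [] => 1
  | b :: l => 2 * toNatLeadingOne l + b.toNat

theorem toNatLeadingOne_pos (l : List Bool) : 0 < toNatLeadingOne l := by
  induction l with
  | nil => simp [toNatLeadingOne]
  | cons b l ih =>
    rw [toNatLeadingOne]
    omega

theorem toNatLeadingOne_lt (l : List Bool) : toNatLeadingOne l < 2 ^ (l.length + 1) := by
  induction l with
  | nil => simp [toNatLeadingOne]
  | cons b l ih =>
    have := b.toNat_lt
    rw [toNatLeadingOne, List.length_cons, pow_succ]
    omega

theorem toNatLeadingOne_injective : Function.Injective toNatLeadingOne := by
  intro l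
  induction l with
  | nil =>
    rintro (_ | ⟨b, l'⟩) h
    · rfl
    · have := toNatLeadingOne_pos l'
      simp only [toNatLeadingOne] at h
      omega
  | cons b l ih =>
    rintro (_ | ⟨b', l'⟩) h
    · have := toNatLeadingOne_pos l
      simp only [toNatLeadingOne] at h
      omega
    · simp only [toNatLeadingOne] at h
      have h₁ := b.toNat_lt
      have h₂ := b'.toNat_lt
      rw [ih (show toNatLeadingOne l = toNatLeadingOne l' by omega)]
      have h₃ : b.toNat = b'.toNat := by omega
      cases b <;> cases b' <;> simp_all

theorem card_le_of_injective_of_length_le {n k : ℕ} (f : Fin n → List Bool)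
    (hf : Function.Injective f) (hk : ∀ i, (f i).length ≤ k) : n < 2 ^ (k + 1) := by
  have h := Finset.card_le_card_of_injOn (s := Finset.univ) (t := Finset.Ioo 0 (2 ^ (k + 1)))
    (fun i => toNatLeadingOne (f i))
    (fun i _ => Finset.mem_coe.2 (Finset.mem_Ioo.2 ⟨toNatLeadingOne_pos _,
      (toNatLeadingOne_lt _).trans_le
        (Nat.pow_le_pow_right two_pos (Nat.add_le_add_right (hk i) 1))⟩))
    ((toNatLeadingOne_injective.comp hf).injOn)
  rw [Finset.card_univ, Fintype.card_fin, Nat.card_Ioo] at h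
  have : 0 < 2 ^ (k + 1) := by positivity
  omega

theorem IsStretchScheme.injective {n : ℕ} {s : ℝ} {e : Encoder n} {d : Decoder}
    (h : IsStretchScheme s e d) (T : TreeOn n) : Function.Injective (e T) := by
  intro u v huv
  have h₁ := (h T u u).2
  have h₂ := (h T u v).1
  rw [SimpleGraph.dist_self, Nat.cast_zero, mul_zero] at h₁
  rw [← huv] at h₂
  have h₃ : T.1.dist u v = 0 := by exact_mod_cast le_antisymm (h₂.trans h₁) (Nat.cast_nonneg _)
  exact (T.2.connected u v).dist_eq_zero_iff.1 h₃

theorem IsStretchScheme.floor_logb_le_size {n : ℕ} (hn : 1 ≤ n) {s : ℝ} {e : Encoder n}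
    {d : Decoder} (h : IsStretchScheme s e d) : ⌊Real.logb 2 n⌋ ≤ (Encoder.size e : ℤ) := by
  have : Nonempty (Fin n) := ⟨⟨0, hn⟩⟩
  -- Any tree will do; this one is a spanning tree of the complete graph.
  obtain ⟨T, _, hT⟩ := (SimpleGraph.connected_top (V := Fin n)).exists_isTree_le
  have hlt := card_le_of_injective_of_length_le (e ⟨T, hT⟩) (h.injective ⟨T, hT⟩)
    (Encoder.length_le_size e ⟨T, hT⟩)
  rw [← Int.lt_add_one_iff, Int.floor_lt, Real.logb_lt_iff_lt_rpow (by norm_num)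
    (by exact_mod_cast hn)]
  push_cast
  exact_mod_cast hlt

end LowerBound

end TreeLabeling

theorem mainTheorem3 (ε : ℝ) (hε : 0 < ε) :
    (∃ (C : ℝ) (d : TreeLabeling.Decoder), 0 < C ∧
      ∀ n : ℕ, 1 ≤ n → ∃ e : TreeLabeling.Encoder n,
        TreeLabeling.IsStretchScheme (1 + ε) e d ∧
          (TreeLabeling.Encoder.size e : ℝ) ≤ C * Real.logb 2 (n : ℝ)) ∧
    (∀ n : ℕ, 1 ≤ n → ∀ (e : TreeLabeling.Encoder n) (d : TreeLabeling.Decoder),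
      TreeLabeling.IsStretchScheme (1 + ε) e d →
        ⌊Real.logb 2 (n : ℝ)⌋ ≤ (TreeLabeling.Encoder.size e : ℤ)) := by
  refine ⟨?_, fun n hn e d h => h.floor_logb_le_size hn⟩
  obtain ⟨δ, K, κ, hpar⟩ := TreeLabeling.exists_suits hε
  obtain ⟨c, hc⟩ := pow_unbounded_of_one_lt (2 : ℝ) (show 1 < 1 + δ by linarith [hpar.pos])
  refine ⟨((3 * c + 2 * (κ + 7) + 7) * 2 : ℕ), TreeLabeling.decoder δ κ, ?_, fun n hn =>
    TreeLabeling.exists_encoder hpar hc.le hn⟩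
  rw [Nat.cast_pos]
  positivity
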